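/- Let $K$ be a field and let $X=\{X_1,\dots,X_n\}$ be a finite set of letters, each $X_i$ being given a weight $n_i>0$ in $\mathbb N$. Grade the free algebra $K\langle X\rangle$ by letting $X_i$ have degree $n_i$, and grade the free algebra $K\langle X,T\rangle$ by letting $X_i$ have degree $n_i$ and $T$ have degree $1$. Fix a total order on the letters $X_i$, extend it by $T<X_i$ for all $i$, and order the monomials (words) of $K\langle X,T\rangle$ by $\prec_{T\text{-}gr}$: first by degree, then lexicographically from left to right; $\mathbf{LM}(f)$ denotes the leading monomial of $f\neq 0$. A subset $\mathcal G$ of a two-sided ideal $J$ of $K\langle X,T\rangle$ is a Gröbner basis of $J$ if for each nonzero $f\in J$ there is a nonzero $g\in\mathcal G$ such that the word $\mathbf{LM}(g)$ is a subword (of consecutive letters) of the word $\mathbf{LM}(f)$. Angle brackets denote generated two-sided ideals. For $F\in K\langle X,T\rangle$ let $F_\sim\in K\langle X\rangle$ be its image under the algebra homomorphism with $X_i\mapsto X_i$, $T\mapsto 1$. For $f=f_p+f_{p-1}+\dots+f_{p-s}\in K\langle X\rangle$ with $f_j$ homogeneous of degree $j$ and $f_p\ne0$, put $\tilde f=f_p+Tf_{p-1}+\dots+T^sf_{p-s}$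 and $\mathbf{LH}(f)=f_p$ (and $\tilde 0=0$, $\mathbf{LH}(0)=0$). A homogeneous element $F$ is dh-closed if $(F_\sim)^\sim=F$. A dh-closed homogeneous Gröbner basis is a set of the form $\mathcal G=\mathcal H\cup\{X_iT-TX_i\mid 1\le i\le n\}$, with $\mathcal H$ a nonempty set of dh-closed homogeneous elements, which is a Gröbner basis of the ideal $\langle\mathcal G\rangle$ of $K\langle X,T\rangle$. Let $\mathcal G$ be a dh-closed homogeneous Gröbner basis in $K\langle X,T\rangle$, put $\mathcal G_\sim=\{g_\sim\mid g\in\mathcal G\}$ and $A=K\langle X\rangle/\langle\mathcal G_\sim\rangle$, and let $F_pA$ be the image in $A$ of $\bigoplus_{i\le p}K\langle X\rangle_i$, for $p\in\mathbb N$, with $F_{-1}A=0$. Let $G(A)=\bigoplus_{p}F_pA/F_{p-1}A$ be the associated graded algebra and $\tilde A=\bigoplus_{p}F_pA$ the Rees algebra of $A$ with respect to this filtration. Then there are isomorphisms of graded $K$-algebras $$G(A)\;\cong\;K\langle X\rangle/\langle\mathbf{LH}(\mathcal G_\sim)\rangle,\qquad \tilde A\;\cong\;K\langle X,T\rangle/\langle\mathcal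 G\rangle,$$ where $\mathbf{LH}(\mathcal G_\sim)=\{\mathbf{LH}(g)\mid g\in\mathcal G_\sim\}$ and the quotients carry the gradings induced from $K\langle X\rangle$ and $K\langle X,T\rangle$. -/

import Mathlib

open scoped DirectSum

noncomputable section

namespace NCGroebner

/-! ### Filtrations, Rees algebras and associated graded algebras -/

/-- An `ℕ`-filtration of a `K`-algebra `A`: an increasing exhaustive family of subspaces
`F₀A ⊆ F₁A ⊆ ⋯` with `1 ∈ F₀A` and `FₚA · F_qA ⊆ F_{p+q}A`. -/
structure NFiltration (K A : Type*) [Field K] [Ring A] [Algebra K A] where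
  /-- The `p`-th filtration step. -/
  F : ℕ → Submodule K A
  one_mem : (1 : A) ∈ F 0
  exhaustive : ∀ a : A, ∃ p, a ∈ F p
  le_succ : ∀ p, F p ≤ F (p + 1)
  mul_mem : ∀ {p q : ℕ} {a b : A}, a ∈ F p → b ∈ F q → a * b ∈ F (p + q)

namespace NFiltration

variable {K A : Type*} [Field K] [Ring A] [Algebra K A] (Φ : NFiltration K A)

theorem mono : Monotone Φ.F := monotone_nat_of_le_succ Φ.le_succ

instance gradedMonoid : SetLike.GradedMonoid Φ.F where
  one_mem := Φ.one_mem
  mul_mem _ _ _ _ ha hb := Φ.mul_mem ha hb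

/-- The Rees algebra `Ã = ⨁ₚ FₚA`, with multiplication induced by that of `A`. -/
abbrev Rees : Type _ := ⨁ p, Φ.F p

/-- The preceding step `F_{p-1}A`, with the convention `F_{-1}A = 0`. -/
def prev : ℕ → Submodule K A
  | 0 => ⊥
  | p + 1 => Φ.F p

theorem mul_prev_mem {p q : ℕ} {a b : A} (ha : a ∈ Φ.F p) (hb : b ∈ Φ.prev q) :
    a * b ∈ Φ.prev (p + q) := by
  cases q with
  | zero =>
    have hb0 : b = 0 := by simpa [prev] using hb
    simp [hb0]
  | succ q => exact Φ.mul_mem ha hb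

theorem prev_mul_mem {p q : ℕ} {a b : A} (ha : a ∈ Φ.prev p) (hb : b ∈ Φ.F q) :
    a * b ∈ Φ.prev (p + q) := by
  cases p with
  | zero =>
    have ha0 : a = 0 := by simpa [prev] using ha
    simp [ha0]
  | succ p =>
    have h : a * b ∈ Φ.F (p + q) := Φ.mul_mem ha hb
    rw [Nat.add_right_comm]
    exact h

/-- The homogeneous part `G(A)ₚ = FₚA / F_{p-1}A` of the associated graded algebra. -/
abbrev Gr (p : ℕ) : Type _ := Φ.F p ⧸ (Φ.prev p).submoduleOf (Φ.F p)

/-- The symbol map `FₚA → G(A)ₚ`. -/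
def symb (p : ℕ) : Φ.F p →ₗ[K] Φ.Gr p := ((Φ.prev p).submoduleOf (Φ.F p)).mkQ

theorem symb_surjective (p : ℕ) : Function.Surjective (Φ.symb p) :=
  Submodule.mkQ_surjective _

/-- Multiplication `FₚA × F_qA → F_{p+q}A`. -/
def mulF (p q : ℕ) : Φ.F p →ₗ[K] Φ.F q →ₗ[K] Φ.F (p + q) :=
  LinearMap.mk₂ K (fun a b => ⟨a.1 * b.1, Φ.mul_mem a.2 b.2⟩)
    (fun _ _ _ => Subtype.ext (add_mul _ _ _))
    (fun _ _ _ => Subtype.ext (smul_mul_assoc _ _ _))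
    (fun _ _ _ => Subtype.ext (mul_add _ _ _))
    (fun _ _ _ => Subtype.ext (mul_smul_comm _ _ _))

theorem symb_eq_zero {p : ℕ} {a : Φ.F p} (ha : a.1 ∈ Φ.prev p) : Φ.symb p a = 0 :=
  (Submodule.Quotient.mk_eq_zero _).2 ha

/-- The multiplication `G(A)ₚ × G(A)_q → G(A)_{p+q}` induced by that of `A`. -/
def mulGr (p q : ℕ) : Φ.Gr p →ₗ[K] Φ.Gr q →ₗ[K] Φ.Gr (p + q) :=
  Submodule.liftQ _
    (LinearMap.flip (Submodule.liftQ _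
      (LinearMap.flip ((Φ.mulF p q).compr₂ (Φ.symb (p + q))))
      (fun b hb => LinearMap.ext fun a =>
        Φ.symb_eq_zero (a := Φ.mulF p q a b) (Φ.mul_prev_mem a.2 hb))))
    (fun a ha => LinearMap.ext fun y => by
      obtain ⟨b, rfl⟩ := Φ.symb_surjective q y
      exact Φ.symb_eq_zero (a := Φ.mulF p q a b) (Φ.prev_mul_mem ha b.2))

theorem mulGr_symb (p q : ℕ) (a : Φ.F p) (b : Φ.F q) :
    Φ.mulGr p q (Φ.symb p a) (Φ.symb q b) =
      Φ.symb (p + q) ⟨a.1 * b.1, Φ.mul_mem a.2 b.2⟩ := rfl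

instance grMul : GradedMonoid.GMul Φ.Gr where
  mul {p q} x y := Φ.mulGr p q x y

instance grOne : GradedMonoid.GOne Φ.Gr where
  one := Φ.symb 0 ⟨1, Φ.one_mem⟩

theorem mk_symb_congr {p q : ℕ} (h : p = q) {a : Φ.F p} {b : Φ.F q} (hab : a.1 = b.1) :
    (GradedMonoid.mk p (Φ.symb p a) : GradedMonoid Φ.Gr) = GradedMonoid.mk q (Φ.symb q b) := by
  subst h
  rw [Subtype.ext hab]

instance grSemiring : DirectSum.GSemiring Φ.Gr where
  mul_zero {p q} a := (Φ.mulGr p q a).map_zero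
  zero_mul {p q} b := by
    change Φ.mulGr p q 0 b = 0
    rw [map_zero, LinearMap.zero_apply]
  mul_add {p q} a b c := (Φ.mulGr p q a).map_add b c
  add_mul {p q} a b c := by
    change Φ.mulGr p q (a + b) c = Φ.mulGr p q a c + Φ.mulGr p q b c
    rw [map_add, LinearMap.add_apply]
  one_mul := by
    rintro ⟨p, x⟩
    obtain ⟨a, rfl⟩ := Φ.symb_surjective p x
    exact Φ.mk_symb_congr (zero_add p) (one_mul a.1)
  mul_one := by
    rintro ⟨p, x⟩
    obtain ⟨a, rfl⟩ := Φ.symb_surjective p x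
    exact Φ.mk_symb_congr (add_zero p) (mul_one a.1)
  mul_assoc := by
    rintro ⟨p, x⟩ ⟨q, y⟩ ⟨r, z⟩
    obtain ⟨a, rfl⟩ := Φ.symb_surjective p x
    obtain ⟨b, rfl⟩ := Φ.symb_surjective q y
    obtain ⟨c, rfl⟩ := Φ.symb_surjective r z
    exact Φ.mk_symb_congr (add_assoc p q r) (mul_assoc a.1 b.1 c.1)
  natCast n := n • Φ.symb 0 ⟨1, Φ.one_mem⟩
  natCast_zero := zero_smul _ _
  natCast_succ n := succ_nsmul _ _

instance grAlgebra : DirectSum.GAlgebra K Φ.Gr where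
  toFun := ((Φ.symb 0).comp (LinearMap.toSpanSingleton K (Φ.F 0) ⟨1, Φ.one_mem⟩)).toAddMonoidHom
  map_one := congrArg (Φ.symb 0) (one_smul K _)
  map_mul r s := Φ.mk_symb_congr rfl (by
    change (r * s) • (1 : A) = (r • (1 : A)) * (s • (1 : A))
    rw [smul_mul_smul_comm, one_mul])
  commutes := by
    rintro r ⟨p, x⟩
    obtain ⟨a, rfl⟩ := Φ.symb_surjective p x
    refine Φ.mk_symb_congr ((zero_add p).trans (add_zero p).symm) ?_
    change (r • (1 : A)) * a.1 = a.1 * (r • (1 : A))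
    rw [smul_mul_assoc, one_mul, mul_smul_comm, mul_one]
  smul_def := by
    rintro r ⟨p, x⟩
    obtain ⟨a, rfl⟩ := Φ.symb_surjective p x
    refine Φ.mk_symb_congr (a := r • a) (zero_add p).symm ?_
    change r • a.1 = (r • (1 : A)) * a.1
    rw [smul_mul_assoc, one_mul]

/-- The associated graded algebra `G(A) = ⨁ₚ FₚA / F_{p-1}A`. -/
abbrev AssocGraded : Type _ := ⨁ p, Φ.Gr p

/-- The filtration induced on the target of a surjective algebra homomorphism `π : A → B`,
i.e. `FₚB = π(FₚA)`. -/
def induced {B : Type*} [Ring B] [Algebra K B] (π : A →ₐ[K] B) (hπ : Function.Surjective π) :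
    NFiltration K B where
  F p := (Φ.F p).map π.toLinearMap
  one_mem := ⟨1, Φ.one_mem, map_one π⟩
  exhaustive b := by
    obtain ⟨a, rfl⟩ := hπ b
    obtain ⟨p, hp⟩ := Φ.exhaustive a
    exact ⟨p, a, hp, rfl⟩
  le_succ p := Submodule.map_mono (Φ.le_succ p)
  mul_mem := by
    rintro p q _ _ ⟨a, ha, rfl⟩ ⟨b, hb, rfl⟩
    exact ⟨a * b, Φ.mul_mem ha hb, map_mul π a b⟩

end NFiltration

/-! ### Graded isomorphisms and quotients -/

/-- `R` (with homogeneous parts `𝒜 p`) and `S` (with homogeneous parts `ℬ p`) are isomorphic as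
graded algebras: some algebra isomorphism maps `𝒜 p` onto `ℬ p` for every `p`. -/
def GradedIso {K R S : Type*} [Field K] [Semiring R] [Algebra K R] [Semiring S] [Algebra K S]
    (𝒜 : ℕ → Submodule K R) (ℬ : ℕ → Submodule K S) : Prop :=
  ∃ e : R ≃ₐ[K] S, ∀ p, (𝒜 p).map e.toLinearMap = ℬ p

/-- The homogeneous parts `FₚA` of the Rees algebra. -/
def reesPart {K A : Type*} [Field K] [Ring A] [Algebra K A] (Φ : NFiltration K A) (p : ℕ) :
    Submodule K Φ.Rees :=
  LinearMap.range (DirectSum.lof K ℕ (fun q => Φ.F q) p)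

/-- The homogeneous parts `FₚA / F_{p-1}A` of the associated graded algebra. -/
def grPart {K A : Type*} [Field K] [Ring A] [Algebra K A] (Φ : NFiltration K A) (p : ℕ) :
    Submodule K Φ.AssocGraded :=
  LinearMap.range (DirectSum.lof K ℕ Φ.Gr p)

/-- `R/⟨S⟩`, where `⟨S⟩` is the two-sided ideal generated by the subset `S`. -/
abbrev Quot {R : Type*} [Ring R] (S : Set R) : Type _ := (TwoSidedIdeal.span S).ringCon.Quotient

/-- The canonical projection `R → R/⟨S⟩`. -/
def proj (K : Type*) {R : Type*} [Field K] [Ring R] [Algebra K R] (S : Set R) :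
    R →ₐ[K] Quot S :=
  RingCon.mkₐ K (TwoSidedIdeal.span S).ringCon

theorem proj_surjective (K : Type*) {R : Type*} [Field K] [Ring R] [Algebra K R] (S : Set R) :
    Function.Surjective (proj K S) :=
  RingCon.mkₐ_surjective _

/-! ### Free algebras with a weight grading -/

section Free

variable {K : Type*} [Field K] {α : Type*}

/-- The monomial of the free algebra given by a word, i.e. an element of its standard basis. -/
def monomial (K : Type*) [Field K] {α : Type*} : FreeMonoid α →* FreeAlgebra K α :=
  FreeMonoid.lift (FreeAlgebra.ι K)

/-- The coefficient of the word `w` in `f`. -/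
def coeff (f : FreeAlgebra K α) (w : FreeMonoid α) : K :=
  (FreeAlgebra.equivMonoidAlgebraFreeMonoid f).coeff w

/-- The finite set of words that occur in `f` with nonzero coefficient. -/
def supp (f : FreeAlgebra K α) : Finset (FreeMonoid α) :=
  (FreeAlgebra.equivMonoidAlgebraFreeMonoid f).coeff.support

/-- The degree of a word, where the letter `a` has degree `wt a`. -/
def wordDeg (wt : α → ℕ) (w : FreeMonoid α) : ℕ := (w.toList.map wt).sum

/-- The homogeneous part of degree `p` of the free algebra, for the weight grading `wt`. -/
def weightPart (K : Type*) [Field K] {α : Type*} (wt : α → ℕ) (p : ℕ) :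
    Submodule K (FreeAlgebra K α) :=
  Submodule.span K {f | ∃ w : FreeMonoid α, wordDeg wt w = p ∧ f = monomial K w}

theorem one_mem_weightPart (wt : α → ℕ) : (1 : FreeAlgebra K α) ∈ weightPart K wt 0 :=
  Submodule.subset_span ⟨1, rfl, (map_one _).symm⟩

theorem weightPart_mul_le (wt : α → ℕ) (p q : ℕ) :
    weightPart K wt p * weightPart K wt q ≤ weightPart K wt (p + q) := by
  rw [weightPart, weightPart, Submodule.span_mul_span]
  refine Submodule.span_mono ?_
  rintro _ ⟨_, ⟨u, rfl, rfl⟩, _, ⟨v, rfl, rfl⟩, rfl⟩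
  exact ⟨u * v, by simp [wordDeg], (map_mul _ _ _).symm⟩

/-- The grading filtration `Fₚ = ⨁_{i ≤ p} K⟨X⟩ᵢ` of the free algebra with a weight grading. -/
def weightFiltration (K : Type*) [Field K] {α : Type*} (wt : α → ℕ) :
    NFiltration K (FreeAlgebra K α) :=
  have hle : ∀ {i p : ℕ}, i ≤ p → weightPart K wt i ≤ ⨆ j ≤ p, weightPart K wt j :=
    fun {i p} h => le_iSup₂_of_le i h le_rfl
  have hmono : ∀ {p q : ℕ}, p ≤ q →
      (⨆ j ≤ p, weightPart K wt j) ≤ ⨆ j ≤ q, weightPart K wt j :=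
    fun h => iSup₂_le fun _ hi => hle (hi.trans h)
  have hmul : ∀ {p q : ℕ} {a b : FreeAlgebra K α}, a ∈ (⨆ j ≤ p, weightPart K wt j) →
      b ∈ (⨆ j ≤ q, weightPart K wt j) → a * b ∈ ⨆ j ≤ p + q, weightPart K wt j := by
    intro p q a b ha hb
    refine (?_ : (⨆ j ≤ p, weightPart K wt j) * (⨆ j ≤ q, weightPart K wt j) ≤ _)
      (Submodule.mul_mem_mul ha hb)
    simp only [Submodule.iSup_mul, Submodule.mul_iSup]
    exact iSup₂_le fun i hi => iSup₂_le fun j hj =>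
      (weightPart_mul_le wt _ _).trans (hle (by omega))
  { F := fun p => ⨆ i ≤ p, weightPart K wt i
    one_mem := hle le_rfl (one_mem_weightPart wt)
    exhaustive := by
      intro a
      induction a using FreeAlgebra.induction with
      | grade0 r =>
        refine ⟨0, ?_⟩
        rw [Algebra.algebraMap_eq_smul_one]
        exact Submodule.smul_mem _ _ (hle le_rfl (one_mem_weightPart wt))
      | grade1 x =>
        exact ⟨wt x, hle le_rfl (Submodule.subset_span
          ⟨FreeMonoid.of x, by simp [wordDeg], by simp [monomial]⟩)⟩
      | mul a b ha hb =>
        obtain ⟨p, hp⟩ := ha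
        obtain ⟨q, hq⟩ := hb
        exact ⟨p + q, hmul hp hq⟩
      | add a b ha hb =>
        obtain ⟨p, hp⟩ := ha
        obtain ⟨q, hq⟩ := hb
        exact ⟨max p q, Submodule.add_mem _ (hmono (le_max_left _ _) hp)
          (hmono (le_max_right _ _) hq)⟩
    le_succ := fun p => hmono (Nat.le_succ p)
    mul_mem := hmul }

open Classical in
/-- The homogeneous component of degree `p` of `f`. -/
def component (wt : α → ℕ) (p : ℕ) (f : FreeAlgebra K α) : FreeAlgebra K α :=
  ∑ w ∈ (supp f).filter (fun w => wordDeg wt w = p), coeff f w • monomial K w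

/-- The degree of `f`, i.e. the largest degree of a word that occurs in `f` (`0` if `f = 0`). -/
def polyDeg (wt : α → ℕ) (f : FreeAlgebra K α) : ℕ := (supp f).sup (wordDeg wt)

/-- The leading homogeneous element `LH(f)`, the nonzero homogeneous component of `f` of the
highest degree (and `LH(0) = 0`). -/
def LH (wt : α → ℕ) (f : FreeAlgebra K α) : FreeAlgebra K α := component wt (polyDeg wt f) f

/-! ### Gröbner bases for the graded lexicographic ordering -/

/-- The graded lexicographic ordering on words: compare degrees first, and words of the same
degree lexicographically from left to right. -/
def GradedLex [LinearOrder α] (wt : α → ℕ) (u v : FreeMonoid α) : Prop :=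
  wordDeg wt u < wordDeg wt v ∨
    (wordDeg wt u = wordDeg wt v ∧ List.Lex (· < ·) u.toList v.toList)

/-- `w` is the leading monomial of `f`: the largest word that occurs in `f`.
(The zero element has no leading monomial.) -/
def IsLM [LinearOrder α] (wt : α → ℕ) (f : FreeAlgebra K α) (w : FreeMonoid α) : Prop :=
  w ∈ supp f ∧ ∀ u ∈ supp f, u ≠ w → GradedLex wt u w

/-- `G` is a Gröbner basis of the two-sided ideal `I`: `G ⊆ I`, and the leading monomial of each
nonzero `f ∈ I` is divisible, as a word, by the leading monomial of some `g ∈ G`. -/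
def IsGroebnerBasis [LinearOrder α] (wt : α → ℕ) (G : Set (FreeAlgebra K α))
    (I : TwoSidedIdeal (FreeAlgebra K α)) : Prop :=
  (∀ g ∈ G, g ∈ I) ∧
    ∀ f ∈ I, f ≠ 0 → ∃ g ∈ G, ∃ u v : FreeMonoid α, IsLM wt g u ∧ IsLM wt f v ∧
      ∃ s t : FreeMonoid α, v = s * u * t

end Free

/-! ### Noncentral homogenization and dehomogenization

For the alphabet `ι` of `K⟨X⟩`, the alphabet of `K⟨X, T⟩` is `WithBot ι`: the letter `⊥` is `T`,
which is smaller than every letter `Xᵢ`. -/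

section Homogenization

variable {K : Type*} [Field K] {ι : Type*}

/-- The weights on the letters of `K⟨X, T⟩`: `T` has degree `1`, `Xᵢ` keeps its degree. -/
def extWt (wt : ι → ℕ) : WithBot ι → ℕ := fun a => WithBot.recBotCoe 1 wt a

/-- The variable `T` of `K⟨X, T⟩`. -/
def T (K : Type*) [Field K] (ι : Type*) : FreeAlgebra K (WithBot ι) := FreeAlgebra.ι K ⊥

/-- The variable `Xᵢ` of `K⟨X, T⟩`. -/
def X (K : Type*) [Field K] {ι : Type*} (i : ι) : FreeAlgebra K (WithBot ι) :=
  FreeAlgebra.ι K (i : WithBot ι)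

/-- The inclusion `K⟨X⟩ → K⟨X, T⟩`. -/
def incl (K : Type*) [Field K] (ι : Type*) : FreeAlgebra K ι →ₐ[K] FreeAlgebra K (WithBot ι) :=
  FreeAlgebra.lift K (X K)

/-- The dehomogenization `F ↦ F_∼`, the algebra homomorphism `K⟨X, T⟩ → K⟨X⟩` with `Xᵢ ↦ Xᵢ` and
`T ↦ 1`. -/
def dehom (K : Type*) [Field K] (ι : Type*) : FreeAlgebra K (WithBot ι) →ₐ[K] FreeAlgebra K ι :=
  FreeAlgebra.lift K fun a => WithBot.recBotCoe 1 (FreeAlgebra.ι K) a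

/-- The noncentral homogenization `f_p + f_{p-1} + ⋯ + f_{p-s} ↦ f_p + T f_{p-1} + ⋯ + T^s f_{p-s}`
with `p` the degree of `f`. -/
def hom (wt : ι → ℕ) (f : FreeAlgebra K ι) : FreeAlgebra K (WithBot ι) :=
  ∑ j ∈ Finset.range (polyDeg wt f + 1),
    T K ι ^ j * incl K ι (component wt (polyDeg wt f - j) f)

/-- `F` is a dh-closed homogeneous element of `K⟨X, T⟩`. -/
def IsDhClosed (wt : ι → ℕ) (F : FreeAlgebra K (WithBot ι)) : Prop :=
  (∃ p, F ∈ weightPart K (extWt wt) p) ∧ hom wt (dehom K ι F) = F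

/-- The set of commutators `Xᵢ T - T Xᵢ`. -/
def commutators (K : Type*) [Field K] (ι : Type*) : Set (FreeAlgebra K (WithBot ι)) :=
  {F | ∃ i : ι, F = X K i * T K ι - T K ι * X K i}

/-- `G` is a dh-closed homogeneous Gröbner basis in `K⟨X, T⟩`: it is the union of a nonempty set of
dh-closed homogeneous elements and of the set of all `Xᵢ T - T Xᵢ`, and it is a Gröbner basis of the
ideal that it generates. -/
def IsDhClosedGroebnerBasis [LinearOrder ι] (wt : ι → ℕ)
    (G : Set (FreeAlgebra K (WithBot ι))) : Prop :=
  (∃ H : Set (FreeAlgebra K (WithBot ι)), H.Nonempty ∧ (∀ F ∈ H, IsDhClosed wt F) ∧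
      G = H ∪ commutators K ι) ∧
    IsGroebnerBasis (extWt wt) G (TwoSidedIdeal.span G)

/-- The filtration of `A = K⟨X⟩/⟨S⟩` induced by the weight grading filtration of `K⟨X⟩`. -/
def quotFiltration (wt : ι → ℕ) (S : Set (FreeAlgebra K ι)) : NFiltration K (Quot S) :=
  (weightFiltration K wt).induced (proj K S) (proj_surjective K S)

/-- The homogeneous parts of the quotient of a free algebra by the ideal generated by `S`:
the images of the homogeneous parts of the free algebra. -/
def quotPart {α : Type*} (wt : α → ℕ) (S : Set (FreeAlgebra K α)) (p : ℕ) :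
    Submodule K (Quot S) :=
  (weightPart K wt p).map (proj K S).toLinearMap

end Homogenization

end NCGroebner

end

namespace NCGroebner

/-! ### Coefficients in the free algebra -/

section Coefficients

variable {K : Type*} [Field K] {α : Type*}

/-! For the Rees algebra, send a homogeneous `F` of degree `p` to the class of `F_∼` in `FₚA`. This
is onto in each degree, since padding with powers of `T` makes the degree-`p` part dehomogenize onto
all elements of degree at most `p`. The kernel is the issue: a homogeneous `F` with `F_∼ ∈ ⟨G_∼⟩`
must lie in `⟨G⟩` (`mem_span_of_dehom_mem`). Every element of `⟨G_∼⟩` is the dehomogenization of a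
homogeneous `P ∈ ⟨G⟩` (`exists_homogeneous_lift`). Modulo the commutators a homogeneous element is
determined by its degree and its dehomogenization (`mem_span_of_dehom_eq_zero`), so `T^q F ≡ T^p P`
once the degrees agree, and `T^q F ∈ ⟨G⟩`.

It remains to cancel `T`, and only here is the Gröbner property used (`mem_span_of_T_mul_mem`).
Since `T` is the smallest letter and the elements of `G` are either commutators or dh-closed, no
leading monomial of `G` starts with `T` (`isLM_ne`). So if it divides `T · LM(F)`, it already
divides `LM(F)`; one reduction step lowers `LM(F)`, and well-founded induction finishes.

For `G(A)`, let `f` be homogeneous of degree `p` with zero symbol: `f - h ∈ ⟨G_∼⟩` for some `h` of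
degree below `p`. By the kernel statement above, some `f - TQ` lies in `⟨G⟩`. Setting `T = 0`
(`evalTZero`) kills commutators and turns a dh-closed `g` into `LH(g_∼)`, hence `f ∈ ⟨LH(G_∼)⟩`
(`mem_span_LH`). -/

theorem equiv_monomial (w : FreeMonoid α) :
    FreeAlgebra.equivMonoidAlgebraFreeMonoid (monomial K w) = MonoidAlgebra.single w 1 := by
  have h : (FreeAlgebra.equivMonoidAlgebraFreeMonoid (R := K) (X := α)).toMonoidHom.comp
      (monomial K) = MonoidAlgebra.of K (FreeMonoid α) := by
    ext x
    simp [monomial, FreeAlgebra.equivMonoidAlgebraFreeMonoid]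
  exact DFunLike.congr_fun h w

open Classical in
theorem coeff_monomial (v w : FreeMonoid α) :
    coeff (monomial K v) w = if v = w then 1 else 0 := by
  rw [coeff, equiv_monomial, MonoidAlgebra.coeff_single, Finsupp.single_apply]

theorem coeff_add (f g : FreeAlgebra K α) (w : FreeMonoid α) :
    coeff (f + g) w = coeff f w + coeff g w := by
  simp [coeff]

theorem coeff_zero (w : FreeMonoid α) : coeff (0 : FreeAlgebra K α) w = 0 := by
  simp [coeff]

theorem coeff_sub (f g : FreeAlgebra K α) (w : FreeMonoid α) :
    coeff (f - g) w = coeff f w - coeff g w := by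
  rw [eq_sub_iff_add_eq, ← coeff_add, sub_add_cancel]

theorem coeff_smul (c : K) (f : FreeAlgebra K α) (w : FreeMonoid α) :
    coeff (c • f) w = c * coeff f w := by
  simp [coeff]

theorem coeff_sum {β : Type*} (s : Finset β) (f : β → FreeAlgebra K α) (w : FreeMonoid α) :
    coeff (∑ b ∈ s, f b) w = ∑ b ∈ s, coeff (f b) w :=
  map_sum (⟨⟨fun g => coeff g w, coeff_zero w⟩, fun _ _ => coeff_add _ _ w⟩ :
    FreeAlgebra K α →+ K) f s

theorem mem_supp {f : FreeAlgebra K α} {w : FreeMonoid α} : w ∈ supp f ↔ coeff f w ≠ 0 :=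
  Finsupp.mem_support_iff

theorem ext_coeff {f g : FreeAlgebra K α} (h : ∀ w, coeff f w = coeff g w) : f = g :=
  FreeAlgebra.equivMonoidAlgebraFreeMonoid.injective
    (MonoidAlgebra.coeff_injective (Finsupp.ext h))

theorem supp_nonempty {f : FreeAlgebra K α} (hf : f ≠ 0) : (supp f).Nonempty := by
  by_contra h
  rw [Finset.not_nonempty_iff_eq_empty] at h
  refine hf (ext_coeff fun w => ?_)
  have hw : w ∉ supp f := by simp [h]
  rw [mem_supp, not_not] at hw
  rw [hw, coeff_zero]

theorem sum_coeff_smul_monomial (f : FreeAlgebra K α) :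
    ∑ w ∈ supp f, coeff f w • monomial K w = f := by
  classical
  refine ext_coeff fun v => ?_
  simp only [coeff_sum, coeff_smul, coeff_monomial, mul_ite, mul_one, mul_zero,
    Finset.sum_ite_eq']
  split_ifs with h
  · rfl
  · rw [mem_supp, not_not] at h
    exact h.symm

theorem span_monomial : Submodule.span K (Set.range (monomial K (α := α))) = ⊤ := by
  refine eq_top_iff.2 fun f _ => ?_
  rw [← sum_coeff_smul_monomial f]
  exact Submodule.sum_mem _ fun w _ =>
    Submodule.smul_mem _ _ (Submodule.subset_span ⟨w, rfl⟩)

theorem monomial_induction {p : FreeAlgebra K α → Prop} (f : FreeAlgebra K α) (zero : p 0)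
    (add : ∀ f g, p f → p g → p (f + g)) (smul : ∀ (c : K) f, p f → p (c • f))
    (mon : ∀ w, p (monomial K w)) : p f := by
  have hf : f ∈ Submodule.span K (Set.range (monomial K (α := α))) := by
    rw [span_monomial]; trivial
  induction hf using Submodule.span_induction with
  | mem x hx => obtain ⟨w, rfl⟩ := hx; exact mon w
  | zero => exact zero
  | add x y _ _ hx hy => exact add x y hx hy
  | smul c x _ hx => exact smul c x hx

theorem coeff_monomial_mul_mul_monomial (s t w : FreeMonoid α) (f : FreeAlgebra K α) :
    coeff (monomial K s * f * monomial K t) (s * w * t) = coeff f w := by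
  induction f using monomial_induction with
  | zero => simp [coeff_zero]
  | add f g hf hg => simp [mul_add, add_mul, coeff_add, hf, hg]
  | smul c f hf => simp [coeff_smul, hf]
  | mon v =>
    rw [← map_mul, ← map_mul, coeff_monomial, coeff_monomial]
    have h : s * v * t = s * w * t ↔ v = w := by
      rw [mul_left_inj, mul_right_inj]
    split_ifs <;> simp_all

theorem coeff_monomial_mul_mul_monomial_of_ne {s t v : FreeMonoid α} (f : FreeAlgebra K α)
    (h : ∀ w, s * w * t ≠ v) : coeff (monomial K s * f * monomial K t) v = 0 := by
  induction f using monomial_induction with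
  | zero => rw [mul_zero, zero_mul, coeff_zero]
  | add f g hf hg => rw [mul_add, add_mul, coeff_add, hf, hg, add_zero]
  | smul c f hf => rw [mul_smul_comm, smul_mul_assoc, coeff_smul, hf, mul_zero]
  | mon w => rw [← map_mul, ← map_mul, coeff_monomial, if_neg (h w)]

theorem exists_of_coeff_monomial_mul_mul_monomial {s t v : FreeMonoid α} {f : FreeAlgebra K α}
    (h : coeff (monomial K s * f * monomial K t) v ≠ 0) :
    ∃ w, s * w * t = v ∧ coeff f w ≠ 0 := by
  by_cases hv : ∃ w, s * w * t = v
  · obtain ⟨w, rfl⟩ := hv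
    exact ⟨w, rfl, by rwa [coeff_monomial_mul_mul_monomial] at h⟩
  · exact absurd (coeff_monomial_mul_mul_monomial_of_ne f (by simpa using hv)) h

/-! ### Word degrees and homogeneous components -/

theorem wordDeg_mul (wt : α → ℕ) (u v : FreeMonoid α) :
    wordDeg wt (u * v) = wordDeg wt u + wordDeg wt v := by
  simp [wordDeg]

theorem wordDeg_of (wt : α → ℕ) (a : α) : wordDeg wt (FreeMonoid.of a) = wt a := by
  simp [wordDeg]

theorem length_le_wordDeg {wt : α → ℕ} (hwt : ∀ a, 0 < wt a) (w : FreeMonoid α) :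
    w.toList.length ≤ wordDeg wt w := by
  unfold wordDeg
  generalize w.toList = l
  induction l with
  | nil => simp
  | cons a l ih =>
    have := hwt a
    simp only [List.length_cons, List.map_cons, List.sum_cons]
    omega

theorem monomial_of (a : α) : monomial K (FreeMonoid.of a) = FreeAlgebra.ι K a := by
  simp [monomial]

theorem monomial_mem_weightPart (wt : α → ℕ) (w : FreeMonoid α) :
    monomial K w ∈ weightPart K wt (wordDeg wt w) :=
  Submodule.subset_span ⟨w, rfl, rfl⟩

theorem ι_mem_weightPart (wt : α → ℕ) (a : α) : FreeAlgebra.ι K a ∈ weightPart K wt (wt a) :=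
  Submodule.subset_span ⟨FreeMonoid.of a, wordDeg_of wt a, (monomial_of a).symm⟩

theorem mul_mem_weightPart {wt : α → ℕ} {p q : ℕ} {f g : FreeAlgebra K α}
    (hf : f ∈ weightPart K wt p) (hg : g ∈ weightPart K wt q) :
    f * g ∈ weightPart K wt (p + q) :=
  weightPart_mul_le wt p q (Submodule.mul_mem_mul hf hg)

theorem wordDeg_eq_of_mem_supp {wt : α → ℕ} {p : ℕ} {f : FreeAlgebra K α}
    (hf : f ∈ weightPart K wt p) {w : FreeMonoid α} (hw : w ∈ supp f) : wordDeg wt w = p := by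
  rw [mem_supp] at hw
  contrapose! hw
  induction hf using Submodule.span_induction with
  | mem x hx =>
    obtain ⟨v, rfl, rfl⟩ := hx
    rw [coeff_monomial, if_neg]
    rintro rfl
    exact hw rfl
  | zero => exact coeff_zero w
  | add x y _ _ hx hy => rw [coeff_add, hx, hy, add_zero]
  | smul c x _ hx => rw [coeff_smul, hx, mul_zero]

theorem iSup_weightPart (wt : α → ℕ) : ⨆ p, weightPart K wt p = ⊤ := by
  rw [eq_top_iff, ← span_monomial, Submodule.span_le]
  rintro _ ⟨w, rfl⟩
  exact Submodule.mem_iSup_of_mem _ (monomial_mem_weightPart wt w)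

theorem LH_ne_zero (wt : α → ℕ) {f : FreeAlgebra K α} (hf : f ≠ 0) : LH wt f ≠ 0 := by
  classical
  obtain ⟨w, hw, hdeg⟩ := Finset.exists_mem_eq_sup (supp f) (supp_nonempty hf) (wordDeg wt)
  intro h
  have h' := congrArg (fun g => coeff g w) h
  simp only [LH, component, coeff_sum, coeff_smul, coeff_monomial, mul_ite, mul_one, mul_zero,
    Finset.sum_ite_eq', coeff_zero] at h'
  rw [if_pos (Finset.mem_filter.2 ⟨hw, hdeg.symm⟩)] at h'
  exact mem_supp.1 hw h'

theorem LH_mem_weightPart (wt : α → ℕ) (f : FreeAlgebra K α) :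
    LH wt f ∈ weightPart K wt (polyDeg wt f) :=
  Submodule.sum_mem _ fun w hw => Submodule.smul_mem _ _
    (Submodule.subset_span ⟨w, (Finset.mem_filter.1 hw).2, rfl⟩)

theorem weightPart_le_weightFiltration (wt : α → ℕ) {i p : ℕ} (h : i ≤ p) :
    weightPart K wt i ≤ (weightFiltration K wt).F p :=
  le_iSup₂_of_le (f := fun i (_ : i ≤ p) => weightPart K wt i) i h le_rfl

/-- Used to see that `LH(r)` has zero symbol in `G(A)` when `r` vanishes in `A`. -/
theorem sub_LH_mem_prev (wt : α → ℕ) (f : FreeAlgebra K α) :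
    f - LH wt f ∈ (weightFiltration K wt).prev (polyDeg wt f) := by
  classical
  have hsplit : f - LH wt f = ∑ w ∈ (supp f).filter (fun w => ¬ wordDeg wt w = polyDeg wt f),
      coeff f w • monomial K w := by
    rw [sub_eq_iff_eq_add, LH, component, add_comm]
    conv_lhs => rw [← sum_coeff_smul_monomial f]
    exact (Finset.sum_filter_add_sum_filter_not _ _ _).symm
  rw [hsplit]
  refine Submodule.sum_mem _ fun w hw => Submodule.smul_mem _ _ ?_
  obtain ⟨hw, hne⟩ := Finset.mem_filter.1 hw
  have hlt : wordDeg wt w < polyDeg wt f := lt_of_le_of_ne (Finset.le_sup hw) hne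
  obtain ⟨m, hm⟩ := Nat.exists_eq_succ_of_ne_zero (Nat.ne_zero_of_lt hlt)
  rw [hm] at hlt ⊢
  exact weightPart_le_weightFiltration wt (Nat.lt_succ_iff.1 hlt) (monomial_mem_weightPart wt w)

end Coefficients

/-! ### The graded lexicographic ordering -/

section Order

variable {K : Type*} [Field K] {α : Type*} [LinearOrder α] {wt : α → ℕ}

theorem GradedLex.trans {u v w : FreeMonoid α} (huv : GradedLex wt u v)
    (hvw : GradedLex wt v w) : GradedLex wt u w := by
  rcases huv with h | ⟨h, h'⟩ <;> rcases hvw with k | ⟨k, k'⟩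
  · exact Or.inl (h.trans k)
  · exact Or.inl (h.trans_eq k)
  · exact Or.inl (h.trans_lt k)
  · exact Or.inr ⟨h.trans k, (lt_trans (α := List α) h' k' : _)⟩

theorem GradedLex.irrefl (u : FreeMonoid α) : ¬ GradedLex wt u u := by
  rintro (h | ⟨_, h⟩)
  · exact lt_irrefl _ h
  · exact lt_irrefl (α := List α) _ h

theorem GradedLex.trichotomy (u v : FreeMonoid α) :
    GradedLex wt u v ∨ u = v ∨ GradedLex wt v u := by
  rcases lt_trichotomy (wordDeg wt u) (wordDeg wt v) with h | h | h
  · exact Or.inl (Or.inl h)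
  · rcases lt_trichotomy (α := List α) u.toList v.toList with k | k | k
    · exact Or.inl (Or.inr ⟨h, k⟩)
    · exact Or.inr (Or.inl (FreeMonoid.toList.injective k))
    · exact Or.inr (Or.inr (Or.inr ⟨h.symm, k⟩))
  · exact Or.inr (Or.inr (Or.inl h))

/-- Right multiplication can spoil the lexicographic order only when one word is a proper prefix of
the other; equal degrees and positive weights exclude this. -/
theorem lex_append_append {wt : α → ℕ} (hwt : ∀ a, 0 < wt a) {l m : List α}
    (h : List.Lex (· < ·) l m) (hdeg : (l.map wt).sum = (m.map wt).sum) (t : List α) :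
    List.Lex (· < ·) (l ++ t) (m ++ t) := by
  induction h with
  | @nil a m =>
    have := hwt a
    simp at hdeg
    omega
  | rel h => exact List.Lex.rel h
  | cons _ ih =>
    refine List.Lex.cons (ih ?_)
    simpa using hdeg

theorem GradedLex.mul_mul (hwt : ∀ a, 0 < wt a) {u v : FreeMonoid α} (h : GradedLex wt u v)
    (s t : FreeMonoid α) : GradedLex wt (s * u * t) (s * v * t) := by
  simp only [GradedLex, wordDeg_mul]
  rcases h with h | ⟨h, h'⟩
  · left; omega
  · refine Or.inr ⟨by rw [h], ?_⟩
    simp only [FreeMonoid.toList_mul, List.append_assoc]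
    exact List.Lex.append_left _ (lex_append_append hwt h' h _) _

theorem GradedLex.wordDeg_le {u v : FreeMonoid α} (h : GradedLex wt u v) :
    wordDeg wt u ≤ wordDeg wt v := by
  rcases h with h | ⟨h, _⟩
  exacts [h.le, h.le]

/-- Positive weights bound the length of a word by its degree, so over a finite alphabet only
finitely many words lie below a given one. Their number serves as a rank. -/
theorem GradedLex.wellFounded [Finite α] (hwt : ∀ a, 0 < wt a) :
    WellFounded (GradedLex wt) := by
  have hfin : ∀ v : FreeMonoid α, {u | GradedLex wt u v}.Finite := fun v =>
    ((List.finite_length_le α (wordDeg wt v)).preimage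
      (FreeMonoid.toList (α := α)).injective.injOn).subset
      fun u hu => (length_le_wordDeg hwt u).trans hu.wordDeg_le
  refine Subrelation.wf (r := InvImage (· < ·) fun v => {u | GradedLex wt u v}.ncard) ?_
    (InvImage.wf _ wellFounded_lt)
  intro u v huv
  refine Set.ncard_lt_ncard ⟨fun w hw => GradedLex.trans hw huv, fun h => ?_⟩ (hfin v)
  exact GradedLex.irrefl u (h huv)

theorem exists_isLM {f : FreeAlgebra K α} (hf : f ≠ 0) : ∃ w, IsLM wt f w := by
  have key : ∀ s : Finset (FreeMonoid α), s.Nonempty →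
      ∃ w ∈ s, ∀ u ∈ s, u ≠ w → GradedLex wt u w := by
    classical
    intro s hs
    induction hs using Finset.Nonempty.cons_induction with
    | singleton a => exact ⟨a, by simp, by simp⟩
    | cons a s ha _ ih =>
      obtain ⟨w, hw, hmax⟩ := ih
      rcases GradedLex.trichotomy (wt := wt) a w with h | h | h
      · refine ⟨w, Finset.mem_cons_of_mem hw, fun u hu hne => ?_⟩
        rcases Finset.mem_cons.1 hu with rfl | hu
        exacts [h, hmax u hu hne]
      · exact absurd (h ▸ hw) ha
      · refine ⟨a, Finset.mem_cons_self a s, fun u hu hne => ?_⟩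
        rcases Finset.mem_cons.1 hu with rfl | hu
        · exact absurd rfl hne
        · by_cases huw : u = w
          · rwa [huw]
          · exact (hmax u hu huw).trans h
  exact key _ (supp_nonempty hf)

theorem IsLM.eq {f : FreeAlgebra K α} {u v : FreeMonoid α} (hu : IsLM wt f u)
    (hv : IsLM wt f v) : u = v := by
  by_contra hne
  exact GradedLex.irrefl u ((hv.2 u hu.1 hne).trans (hu.2 v hv.1 (Ne.symm hne)))

theorem IsLM.ne_zero {f : FreeAlgebra K α} {u : FreeMonoid α} (hu : IsLM wt f u) : f ≠ 0 := by
  rintro rfl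
  exact mem_supp.1 hu.1 (coeff_zero u)

theorem IsLM.mul_mul (hwt : ∀ a, 0 < wt a) {f : FreeAlgebra K α} {u : FreeMonoid α}
    (hu : IsLM wt f u) (s t : FreeMonoid α) :
    IsLM wt (monomial K s * f * monomial K t) (s * u * t) := by
  refine ⟨?_, fun w hw hne => ?_⟩
  · rw [mem_supp, coeff_monomial_mul_mul_monomial]
    exact mem_supp.1 hu.1
  · obtain ⟨w, rfl, hfw⟩ := exists_of_coeff_monomial_mul_mul_monomial (mem_supp.1 hw)
    exact (hu.2 w (mem_supp.2 hfw) (by rintro rfl; exact hne rfl)).mul_mul hwt s t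

/-- Cancelling the leading term of `f` against an element with the same leading monomial. -/
theorem IsLM.sub_smul {f g : FreeAlgebra K α} {u w : FreeMonoid α} (hf : IsLM wt f u)
    (hg : IsLM wt g u) (hw : w ∈ supp (f - (coeff f u / coeff g u) • g)) :
    GradedLex wt w u := by
  rw [mem_supp, coeff_sub, coeff_smul] at hw
  have hgu := mem_supp.1 hg.1
  by_cases hwu : w = u
  · subst hwu
    exact absurd (by field_simp; simp) hw
  · by_cases hfw : coeff f w = 0
    · refine hg.2 w (mem_supp.2 ?_) hwu
      rintro h0
      simp [hfw, h0] at hw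
    · exact hf.2 w (mem_supp.2 hfw) hwu

end Order

/-! ### Homogeneous elements of the free algebra with the extra letter `T` -/

theorem proj_eq_zero {K R : Type*} [Field K] [Ring R] [Algebra K R] {S : Set R} {x : R} :
    proj K S x = 0 ↔ x ∈ TwoSidedIdeal.span S :=
  (RingCon.eq _).trans (TwoSidedIdeal.mem_iff _ _).symm

theorem smul_mem_twoSidedIdeal {K R : Type*} [Field K] [Ring R] [Algebra K R]
    {I : TwoSidedIdeal R} (c : K) {x : R} (hx : x ∈ I) : c • x ∈ I := by
  rw [Algebra.smul_def]
  exact I.mul_mem_left _ _ hx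

section Homogenization

variable {K : Type*} [Field K] {ι : Type*} {wt : ι → ℕ}

/-- The algebra homomorphism `K⟨X, T⟩ → K⟨X⟩` with `Xᵢ ↦ Xᵢ` and `T ↦ 0`. -/
noncomputable def evalTZero (K : Type*) [Field K] (ι : Type*) :
    FreeAlgebra K (WithBot ι) →ₐ[K] FreeAlgebra K ι :=
  FreeAlgebra.lift K fun a => WithBot.recBotCoe 0 (FreeAlgebra.ι K) a

@[simp] theorem evalTZero_T : evalTZero K ι (T K ι) = 0 := by simp [evalTZero, T]

@[simp] theorem evalTZero_X (i : ι) : evalTZero K ι (X K i) = FreeAlgebra.ι K i := by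
  simp [evalTZero, X]

@[simp] theorem dehom_T : dehom K ι (T K ι) = 1 := by simp [dehom, T]

@[simp] theorem dehom_X (i : ι) : dehom K ι (X K i) = FreeAlgebra.ι K i := by
  simp [dehom, X]

@[simp] theorem incl_ι (i : ι) : incl K ι (FreeAlgebra.ι K i) = X K i := by
  simp [incl]

@[simp] theorem evalTZero_incl (f : FreeAlgebra K ι) : evalTZero K ι (incl K ι f) = f := by
  have h : (evalTZero K ι).comp (incl K ι) = AlgHom.id K _ := by
    ext i; simp
  exact DFunLike.congr_fun h f

@[simp] theorem dehom_incl (f : FreeAlgebra K ι) : dehom K ι (incl K ι f) = f := by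
  have h : (dehom K ι).comp (incl K ι) = AlgHom.id K _ := by
    ext i; simp
  exact DFunLike.congr_fun h f

/-- Every term of the homogenization except the one with `T^0` is killed by `T = 0`. -/
theorem evalTZero_hom (f : FreeAlgebra K ι) : evalTZero K ι (hom wt f) = LH wt f := by
  rw [hom, map_sum, Finset.sum_range_succ']
  simp [LH]

/-! ### Degrees and dehomogenization in `K⟨X, T⟩` -/

theorem T_mem_weightPart : T K ι ∈ weightPart K (extWt wt) 1 :=
  ι_mem_weightPart (extWt wt) ⊥

theorem X_mem_weightPart (i : ι) : X K i ∈ weightPart K (extWt wt) (wt i) :=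
  ι_mem_weightPart (extWt wt) (i : WithBot ι)

theorem T_pow_mem_weightPart (k : ℕ) : T K ι ^ k ∈ weightPart K (extWt wt) k := by
  induction k with
  | zero => simpa using one_mem_weightPart (extWt wt)
  | succ k ih => rw [pow_succ]; exact mul_mem_weightPart ih T_mem_weightPart

theorem incl_mem_weightPart {p : ℕ} {f : FreeAlgebra K ι} (hf : f ∈ weightPart K wt p) :
    incl K ι f ∈ weightPart K (extWt wt) p := by
  suffices h : weightPart K wt p ≤ (weightPart K (extWt wt) p).comap (incl K ι).toLinearMap from
    h hf
  refine Submodule.span_le.2 ?_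
  rintro _ ⟨w, rfl, rfl⟩
  clear hf
  change incl K ι (monomial K w) ∈ weightPart K (extWt wt) (wordDeg wt w)
  induction w using FreeMonoid.inductionOn' with
  | one => simpa [wordDeg] using one_mem_weightPart (extWt wt)
  | of_mul i w ih =>
    rw [map_mul, map_mul, wordDeg_mul, monomial_of, wordDeg_of, incl_ι]
    exact mul_mem_weightPart (X_mem_weightPart i) ih

theorem commutator_mem_weightPart (i : ι) :
    X K i * T K ι - T K ι * X K i ∈ weightPart K (extWt wt) (wt i + 1) := by
  refine Submodule.sub_mem _ (mul_mem_weightPart (X_mem_weightPart i) T_mem_weightPart) ?_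
  rw [add_comm]
  exact mul_mem_weightPart T_mem_weightPart (X_mem_weightPart i)

/-- Modulo the commutators all letters `T` of a word can be moved to the front; `k` counts them and
`v` is what remains after deleting them. -/
theorem dehom_monomial (w : FreeMonoid (WithBot ι)) : ∃ v : FreeMonoid ι, ∃ k : ℕ,
    k + wordDeg wt v = wordDeg (extWt wt) w ∧ dehom K ι (monomial K w) = monomial K v ∧
      ∀ G, commutators K ι ⊆ G →
        proj K G (monomial K w) = proj K G (T K ι ^ k * incl K ι (monomial K v)) := by
  induction w using FreeMonoid.inductionOn' with
  | one => exact ⟨1, 0, rfl, by simp, fun G _ => by simp⟩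
  | of_mul a w ih =>
    obtain ⟨v, k, hdeg, hv, hw⟩ := ih
    induction a using WithBot.recBotCoe with
    | bot =>
      refine ⟨v, k + 1, ?_, ?_, fun G hG => ?_⟩
      · rw [wordDeg_mul, wordDeg_of, ← hdeg]
        change k + 1 + wordDeg wt v = 1 + (k + wordDeg wt v)
        omega
      · rw [map_mul, map_mul, hv, monomial_of]
        change dehom K ι (T K ι) * _ = _
        rw [dehom_T, one_mul]
      · rw [map_mul, map_mul, hw G hG, monomial_of, ← map_mul, pow_succ', mul_assoc]
        rfl
    | coe i =>
      refine ⟨FreeMonoid.of i * v, k, ?_, ?_, fun G hG => ?_⟩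
      · rw [wordDeg_mul, wordDeg_of, wordDeg_mul, wordDeg_of, ← hdeg]
        change k + (wt i + wordDeg wt v) = wt i + (k + wordDeg wt v)
        omega
      · rw [map_mul, map_mul, hv, monomial_of, map_mul, monomial_of]
        change dehom K ι (X K i) * _ = _
        rw [dehom_X]
      · have hc : Commute (proj K G (X K i)) (proj K G (T K ι)) := by
          rw [commute_iff_eq, ← map_mul, ← map_mul, ← sub_eq_zero, ← map_sub, proj_eq_zero]
          exact TwoSidedIdeal.subset_span (hG ⟨i, rfl⟩)
        rw [map_mul, map_mul, hw G hG, monomial_of, map_mul, map_mul, map_mul, map_mul, map_mul,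
          monomial_of, incl_ι, map_pow, ← mul_assoc, ← mul_assoc, ← (hc.pow_right k).eq]
        rfl

theorem map_dehom_weightPart (p : ℕ) :
    (weightPart K (extWt wt) p).map (dehom K ι).toLinearMap = (weightFiltration K wt).F p := by
  refine le_antisymm ?_ (iSup₂_le fun i hi => ?_)
  · rw [Submodule.map_le_iff_le_comap]
    refine Submodule.span_le.2 ?_
    rintro _ ⟨w, rfl, rfl⟩
    obtain ⟨v, k, hdeg, hv, -⟩ := dehom_monomial (K := K) (wt := wt) w
    change dehom K ι (monomial K w) ∈ (weightFiltration K wt).F (wordDeg (extWt wt) w)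
    rw [hv]
    exact weightPart_le_weightFiltration wt (by omega) (monomial_mem_weightPart wt v)
  · intro f hf
    -- Powers of `T` make up the missing degree and disappear under dehomogenization.
    refine ⟨T K ι ^ (p - i) * incl K ι f, ?_, by simp⟩
    have h := mul_mem_weightPart (T_pow_mem_weightPart (K := K) (wt := wt) (p - i))
      (incl_mem_weightPart hf)
    rwa [Nat.sub_add_cancel hi] at h

theorem dehom_mem {p : ℕ} {F : FreeAlgebra K (WithBot ι)} (hF : F ∈ weightPart K (extWt wt) p) :
    dehom K ι F ∈ (weightFiltration K wt).F p := by
  rw [← map_dehom_weightPart]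
  exact ⟨F, hF, rfl⟩

theorem exists_dehom_eq {p : ℕ} {f : FreeAlgebra K ι} (hf : f ∈ (weightFiltration K wt).F p) :
    ∃ F ∈ weightPart K (extWt wt) p, dehom K ι F = f := by
  rw [← map_dehom_weightPart] at hf
  exact hf

theorem basisFreeMonoid_eq_monomial (w : FreeMonoid ι) :
    FreeAlgebra.basisFreeMonoid K ι w = monomial K w := by
  apply FreeAlgebra.equivMonoidAlgebraFreeMonoid.injective
  rw [equiv_monomial]
  simp [FreeAlgebra.basisFreeMonoid]

/-- Modulo the commutators, a homogeneous element is determined by its degree and its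
dehomogenization. -/
theorem mem_span_of_dehom_eq_zero {G : Set (FreeAlgebra K (WithBot ι))}
    (hG : commutators K ι ⊆ G) {p : ℕ} {F : FreeAlgebra K (WithBot ι)}
    (hF : F ∈ weightPart K (extWt wt) p) (h0 : dehom K ι F = 0) : F ∈ TwoSidedIdeal.span G := by
  -- `L` rehomogenizes to the fixed degree `p`, with `T` on the left. On words of degree above `p`
  -- the truncated subtraction gives a junk value, but such words do not arise from an `F` of degree
  -- `p`.
  let L : FreeAlgebra K ι →ₗ[K] FreeAlgebra K (WithBot ι) :=
    (FreeAlgebra.basisFreeMonoid K ι).constr K fun w =>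
      T K ι ^ (p - wordDeg wt w) * incl K ι (monomial K w)
  have hL : ∀ w, L (monomial K w) = T K ι ^ (p - wordDeg wt w) * incl K ι (monomial K w) := by
    intro w
    have h := (FreeAlgebra.basisFreeMonoid K ι).constr_basis (S := K)
      (fun w => T K ι ^ (p - wordDeg wt w) * incl K ι (monomial K w)) w
    rwa [basisFreeMonoid_eq_monomial] at h
  have key : proj K G F = proj K G (L (dehom K ι F)) := by
    clear h0
    induction hF using Submodule.span_induction with
    | mem x hx =>
      obtain ⟨w, rfl, rfl⟩ := hx
      obtain ⟨v, k, hdeg, hv, hw⟩ := dehom_monomial (K := K) (wt := wt) w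
      rw [hw G hG, hv, hL, ← hdeg, Nat.add_sub_cancel]
    | zero => simp
    | add x y _ _ hx hy => simp only [map_add, hx, hy]
    | smul c x _ hx => simp only [map_smul, hx]
  rwa [h0, map_zero, map_zero, proj_eq_zero] at key

theorem extWt_pos (hwt : ∀ i, 0 < wt i) (a : WithBot ι) : 0 < extWt wt a := by
  induction a using WithBot.recBotCoe with
  | bot => exact Nat.one_pos
  | coe i => exact hwt i

/-- If all words of `F` started with `T`, each of them would vanish at `T = 0`. -/
theorem exists_mem_supp_evalTZero {F : FreeAlgebra K (WithBot ι)} (hF : evalTZero K ι F ≠ 0) :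
    ∃ w ∈ supp F, ∀ v, w ≠ FreeMonoid.of ⊥ * v := by
  contrapose! hF
  rw [← sum_coeff_smul_monomial F, map_sum]
  refine Finset.sum_eq_zero fun w hw => ?_
  obtain ⟨v, rfl⟩ := hF w hw
  rw [map_smul, map_mul, map_mul, monomial_of]
  change _ • (evalTZero K ι (T K ι) * _) = _
  rw [evalTZero_T, zero_mul, smul_zero]

end Homogenization

/-! ### Gröbner bases and `T`-torsion -/

section Torsion

variable {K : Type*} [Field K] {ι : Type*} [LinearOrder ι] {wt : ι → ℕ}

/-- By homogeneity the comparison of words of `F` is purely lexicographic, and `T` is the smallest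
letter, so a word starting with `T` loses to any word of `F` that does not. Positive weights exclude
that the latter is empty. -/
theorem IsLM.ne_of_bot_mul (hwt : ∀ i, 0 < wt i) {F : FreeAlgebra K (WithBot ι)} {p : ℕ}
    (hF : F ∈ weightPart K (extWt wt) p) {u w : FreeMonoid (WithBot ι)}
    (hu : IsLM (extWt wt) F u) (hw : w ∈ supp F) (hne : ∀ v, w ≠ FreeMonoid.of ⊥ * v)
    (v : FreeMonoid (WithBot ι)) : u ≠ FreeMonoid.of ⊥ * v := by
  rintro rfl
  have hdeg := (wordDeg_eq_of_mem_supp hF hw).trans (wordDeg_eq_of_mem_supp hF hu.1).symm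
  rcases hu.2 w hw (hne v) with h | ⟨-, h⟩
  · exact h.ne hdeg
  · induction w using FreeMonoid.casesOn with
    | one =>
      rw [wordDeg_mul, wordDeg_of] at hdeg
      have := extWt_pos hwt ⊥
      simp only [wordDeg, FreeMonoid.toList_one, List.map_nil, List.sum_nil] at hdeg
      omega
    | of_mul a w =>
      simp only [FreeMonoid.toList_mul, FreeMonoid.toList_of, List.cons_append,
        List.nil_append] at h
      cases h with
      | rel h => exact not_lt_bot h
      | cons h => exact hne w rfl

variable {G : Set (FreeAlgebra K (WithBot ι))}

theorem IsDhClosedGroebnerBasis.commutators_subset (hG : IsDhClosedGroebnerBasis wt G) :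
    commutators K ι ⊆ G := by
  obtain ⟨⟨H, -, -, rfl⟩, -⟩ := hG
  exact Set.subset_union_right

theorem IsDhClosedGroebnerBasis.exists_mem_weightPart (hG : IsDhClosedGroebnerBasis wt G)
    {g : FreeAlgebra K (WithBot ι)} (hg : g ∈ G) : ∃ p, g ∈ weightPart K (extWt wt) p := by
  obtain ⟨⟨H, -, hH, rfl⟩, -⟩ := hG
  rcases hg with hg | ⟨i, rfl⟩
  exacts [(hH g hg).1, ⟨_, commutator_mem_weightPart i⟩]

theorem IsDhClosedGroebnerBasis.evalTZero_eq (hG : IsDhClosedGroebnerBasis wt G)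
    {g : FreeAlgebra K (WithBot ι)} (hg : g ∈ G) :
    evalTZero K ι g = 0 ∨ evalTZero K ι g = LH wt (dehom K ι g) := by
  obtain ⟨⟨H, -, hH, rfl⟩, -⟩ := hG
  rcases hg with hg | ⟨i, rfl⟩
  · right
    conv_lhs => rw [← (hH g hg).2, evalTZero_hom]
  · left
    simp

/-- The leading monomials of a dh-closed homogeneous Gröbner basis do not start with `T`. -/
theorem IsDhClosedGroebnerBasis.isLM_ne (hwt : ∀ i, 0 < wt i)
    (hG : IsDhClosedGroebnerBasis wt G) {g : FreeAlgebra K (WithBot ι)} (hg : g ∈ G)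
    {u : FreeMonoid (WithBot ι)} (hu : IsLM (extWt wt) g u) (v : FreeMonoid (WithBot ι)) :
    u ≠ FreeMonoid.of ⊥ * v := by
  obtain ⟨⟨H, -, hH, rfl⟩, -⟩ := hG
  rcases hg with hg | ⟨i, rfl⟩
  · obtain ⟨⟨p, hp⟩, hdh⟩ := hH g hg
    -- Since `g` is the homogenization of `g_∼`, its value at `T = 0` is `LH(g_∼)`, which is nonzero
    -- because `g` is.
    have hne : evalTZero K ι g ≠ 0 := by
      rw [← hdh, evalTZero_hom]
      refine LH_ne_zero wt fun h => hu.ne_zero ?_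
      rw [← hdh, h]
      simp [hom, component, supp]
    obtain ⟨w, hw, hwne⟩ := exists_mem_supp_evalTZero hne
    exact hu.ne_of_bot_mul hwt hp hw hwne v
  · have hne : ∀ v, FreeMonoid.of (i : WithBot ι) * FreeMonoid.of ⊥ ≠ FreeMonoid.of ⊥ * v := by
      intro v h
      have h' := congrArg FreeMonoid.toList h
      simp at h'
    refine hu.ne_of_bot_mul hwt (commutator_mem_weightPart i)
      (w := FreeMonoid.of (i : WithBot ι) * FreeMonoid.of ⊥) ?_ hne v
    have hX : X K i * T K ι = monomial K (FreeMonoid.of (i : WithBot ι) * FreeMonoid.of ⊥) := by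
      rw [map_mul, monomial_of, monomial_of]; rfl
    have hT : T K ι * X K i = monomial K (FreeMonoid.of ⊥ * FreeMonoid.of (i : WithBot ι)) := by
      rw [map_mul, monomial_of, monomial_of]; rfl
    rw [mem_supp, hX, hT, coeff_sub, coeff_monomial, coeff_monomial, if_pos rfl,
      if_neg (hne _).symm]
    simp

/-- The quotient of `K⟨X, T⟩` by a dh-closed homogeneous Gröbner basis has no `T`-torsion. -/
theorem IsDhClosedGroebnerBasis.mem_span_of_T_mul_mem [Finite ι] (hwt : ∀ i, 0 < wt i)
    (hG : IsDhClosedGroebnerBasis wt G) {F : FreeAlgebra K (WithBot ι)}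
    (hF : T K ι * F ∈ TwoSidedIdeal.span G) : F ∈ TwoSidedIdeal.span G := by
  have hpos := extWt_pos hwt
  suffices h : ∀ v, ∀ F : FreeAlgebra K (WithBot ι), IsLM (extWt wt) F v →
      T K ι * F ∈ TwoSidedIdeal.span G → F ∈ TwoSidedIdeal.span G by
    by_cases h0 : F = 0
    · rw [h0]; exact TwoSidedIdeal.zero_mem _
    · obtain ⟨v, hv⟩ := exists_isLM (wt := extWt wt) h0
      exact h v F hv hF
  have : Finite (WithBot ι) := inferInstanceAs (Finite (Option ι))
  intro v
  induction v using (GradedLex.wellFounded hpos).induction with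
  | _ v ih =>
  intro F hFv hTF
  have hTv : IsLM (extWt wt) (T K ι * F) (FreeMonoid.of ⊥ * v) := by
    have h := hFv.mul_mul hpos (FreeMonoid.of ⊥) 1
    rwa [map_one, mul_one, mul_one, monomial_of] at h
  obtain ⟨g, hg, u, v', hgu, hv', s, t, hst⟩ := hG.2.2 _ hTF hTv.ne_zero
  -- From `T v = s u t`: if `s` is nonempty, drop its first letter `T`; if `s` is empty, a nonempty
  -- `u` would start with `T`, which is impossible, and an empty `u` divides everything.
  have hdvd : ∃ s t, v = s * u * t := by
    rw [hv'.eq hTv] at hst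
    induction s using FreeMonoid.casesOn with
    | one =>
      rw [one_mul] at hst
      induction u using FreeMonoid.casesOn with
      | one => exact ⟨1, v, by simp⟩
      | of_mul a u =>
        have h' : ⊥ = a := by
          simpa using congrArg (fun w => w.toList.head?) hst
        exact absurd (by rw [h']) (hG.isLM_ne hwt hg hgu u)
    | of_mul a s =>
      refine ⟨s, t, ?_⟩
      simpa [mul_assoc] using congrArg (fun w => FreeMonoid.ofList w.toList.tail) hst
  obtain ⟨s, t, rfl⟩ := hdvd
  have hred := hgu.mul_mul hpos s t
  set g' := monomial K s * g * monomial K t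
  have hg' : g' ∈ TwoSidedIdeal.span G :=
    TwoSidedIdeal.mul_mem_right _ _ _
      (TwoSidedIdeal.mul_mem_left _ _ _ (TwoSidedIdeal.subset_span hg))
  have hcg := smul_mem_twoSidedIdeal (coeff F (s * u * t) / coeff g' (s * u * t)) hg'
  -- The scalar cancels the leading term of `F`, so the induction hypothesis applies to the
  -- difference unless it is zero.
  have hdiff : F - (coeff F (s * u * t) / coeff g' (s * u * t)) • g' ∈
      TwoSidedIdeal.span G := by
    by_cases h0 : F - (coeff F (s * u * t) / coeff g' (s * u * t)) • g' = 0
    · rw [h0]; exact TwoSidedIdeal.zero_mem _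
    · obtain ⟨w, hw⟩ := exists_isLM (wt := extWt wt) h0
      refine ih w (hFv.sub_smul hred hw.1) _ hw ?_
      rw [mul_sub]
      exact TwoSidedIdeal.sub_mem _ hTF (TwoSidedIdeal.mul_mem_left _ _ _ hcg)
  simpa using TwoSidedIdeal.add_mem _ hdiff hcg

theorem IsDhClosedGroebnerBasis.mem_span_of_T_pow_mul_mem [Finite ι] (hwt : ∀ i, 0 < wt i)
    (hG : IsDhClosedGroebnerBasis wt G) {F : FreeAlgebra K (WithBot ι)} {k : ℕ}
    (hF : T K ι ^ k * F ∈ TwoSidedIdeal.span G) : F ∈ TwoSidedIdeal.span G := by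
  induction k with
  | zero => simpa using hF
  | succ k ih =>
    rw [pow_succ', mul_assoc] at hF
    exact ih (hG.mem_span_of_T_mul_mem hwt hF)

/-- The elements with such a lift form a two-sided ideal containing `G_∼`. For sums, lifts of
degrees `p` and `q` are both raised to degree `p + q` by powers of `T`; for products, the outer
factor is itself lifted homogeneously. -/
theorem IsDhClosedGroebnerBasis.exists_homogeneous_lift (hG : IsDhClosedGroebnerBasis wt G)
    {f : FreeAlgebra K ι} (hf : f ∈ TwoSidedIdeal.span (dehom K ι '' G)) :
    ∃ p, ∃ F ∈ weightPart K (extWt wt) p, F ∈ TwoSidedIdeal.span G ∧ dehom K ι F = f := by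
  have hlift : ∀ a : FreeAlgebra K ι, ∃ p, ∃ F ∈ weightPart K (extWt wt) p, dehom K ι F = a := by
    intro a
    obtain ⟨p, hp⟩ := (weightFiltration K wt).exhaustive a
    exact ⟨p, exists_dehom_eq hp⟩
  induction hf using TwoSidedIdeal.span_induction with
  | mem x hx =>
    obtain ⟨g, hg, rfl⟩ := hx
    obtain ⟨p, hp⟩ := hG.exists_mem_weightPart hg
    exact ⟨p, g, hp, TwoSidedIdeal.subset_span hg, rfl⟩
  | zero => exact ⟨0, 0, Submodule.zero_mem _, TwoSidedIdeal.zero_mem _, map_zero _⟩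
  | add x y _ _ hx hy =>
    obtain ⟨p, F, hF, hFG, rfl⟩ := hx
    obtain ⟨q, F', hF', hFG', rfl⟩ := hy
    refine ⟨p + q, T K ι ^ q * F + T K ι ^ p * F', Submodule.add_mem _ ?_
      (mul_mem_weightPart (T_pow_mem_weightPart p) hF'),
      TwoSidedIdeal.add_mem _ (TwoSidedIdeal.mul_mem_left _ _ _ hFG)
        (TwoSidedIdeal.mul_mem_left _ _ _ hFG'), by simp⟩
    rw [add_comm p q]
    exact mul_mem_weightPart (T_pow_mem_weightPart q) hF
  | neg x _ hx =>
    obtain ⟨p, F, hF, hFG, rfl⟩ := hx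
    exact ⟨p, -F, Submodule.neg_mem _ hF, TwoSidedIdeal.neg_mem _ hFG, map_neg _ _⟩
  | left_absorb a x _ hx =>
    obtain ⟨p, F, hF, hFG, rfl⟩ := hx
    obtain ⟨q, A, hA, rfl⟩ := hlift a
    exact ⟨q + p, A * F, mul_mem_weightPart hA hF, TwoSidedIdeal.mul_mem_left _ _ _ hFG,
      map_mul _ _ _⟩
  | right_absorb a x _ hx =>
    obtain ⟨p, F, hF, hFG, rfl⟩ := hx
    obtain ⟨q, A, hA, rfl⟩ := hlift a
    exact ⟨p + q, F * A, mul_mem_weightPart hF hA, TwoSidedIdeal.mul_mem_right _ _ _ hFG,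
      map_mul _ _ _⟩

/-- A homogeneous element lies in the ideal of a dh-closed homogeneous Gröbner basis as soon as its
dehomogenization lies in the dehomogenized ideal. -/
theorem IsDhClosedGroebnerBasis.mem_span_of_dehom_mem [Finite ι] (hwt : ∀ i, 0 < wt i)
    (hG : IsDhClosedGroebnerBasis wt G) {F : FreeAlgebra K (WithBot ι)} {p : ℕ}
    (hF : F ∈ weightPart K (extWt wt) p)
    (hd : dehom K ι F ∈ TwoSidedIdeal.span (dehom K ι '' G)) : F ∈ TwoSidedIdeal.span G := by
  obtain ⟨q, P, hP, hPG, hPF⟩ := hG.exists_homogeneous_lift hd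
  have hPp : T K ι ^ p * P ∈ weightPart K (extWt wt) (q + p) := by
    rw [add_comm]
    exact mul_mem_weightPart (T_pow_mem_weightPart p) hP
  -- Both terms have degree `p + q` and the same dehomogenization, so they agree modulo the
  -- commutators.
  have hdiff : T K ι ^ q * F - T K ι ^ p * P ∈ TwoSidedIdeal.span G :=
    mem_span_of_dehom_eq_zero hG.commutators_subset
      (Submodule.sub_mem _ (mul_mem_weightPart (T_pow_mem_weightPart q) hF) hPp) (by simp [hPF])
  refine hG.mem_span_of_T_pow_mul_mem hwt (k := q) ?_
  simpa using TwoSidedIdeal.add_mem _ hdiff (TwoSidedIdeal.mul_mem_left _ (T K ι ^ p) _ hPG)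

end Torsion

/-! ### Graded homomorphisms from the free algebra -/

section GradedHom

variable {K : Type*} [Field K] {α : Type*} {wt : α → ℕ}

/-- A homomorphism onto a graded algebra that respects the grading, and whose kernel is generated
by `S` in each degree, induces a graded isomorphism with the quotient by `S`. -/
theorem gradedIso_quotPart {S : Set (FreeAlgebra K α)} {B : ℕ → Type*}
    [∀ p, AddCommMonoid (B p)] [∀ p, Module K (B p)] [DirectSum.GSemiring B]
    [DirectSum.GAlgebra K B] (φ : FreeAlgebra K α →ₐ[K] ⨁ p, B p)
    (hmap : ∀ p, (weightPart K wt p).map φ.toLinearMap =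
      LinearMap.range (DirectSum.lof K ℕ B p))
    (hS : ∀ s ∈ S, φ s = 0)
    (hker : ∀ p, ∀ f ∈ weightPart K wt p, φ f = 0 → f ∈ TwoSidedIdeal.span S) :
    GradedIso (R := ⨁ p, B p) (S := Quot S) (fun p => LinearMap.range (DirectSum.lof K ℕ B p))
      (quotPart wt S) := by
  have hspan : TwoSidedIdeal.span S ≤ TwoSidedIdeal.ker φ :=
    TwoSidedIdeal.span_le.2 fun s hs => (TwoSidedIdeal.mem_ker φ).2 (hS s hs)
  have hle : (TwoSidedIdeal.span S).ringCon ≤ RingCon.ker φ.toRingHom := by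
    intro x y hxy
    have h0 := (TwoSidedIdeal.mem_ker φ).1 (hspan ((TwoSidedIdeal.rel_iff _ _ _).1 hxy))
    change φ x = φ y
    rw [← sub_add_cancel x y, map_add, h0, zero_add]
  -- Because `φ` respects degrees, `φ f = 0` forces `φ` to vanish on each homogeneous component of
  -- `f`, where the degreewise hypothesis applies.
  have hker' : ∀ f, φ f = 0 → f ∈ TwoSidedIdeal.span S := by
    intro f hf
    have hf' : f ∈ ⨆ p, weightPart K wt p := by rw [iSup_weightPart]; trivial
    obtain ⟨x, hx, rfl⟩ := (Submodule.mem_iSup_iff_exists_finsupp _ _).1 hf'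
    have hb : ∀ p, ∃ b, DirectSum.lof K ℕ B p b = φ (x p) := fun p => by
      have h : φ (x p) ∈ (weightPart K wt p).map φ.toLinearMap := ⟨x p, hx p, rfl⟩
      rw [hmap] at h
      exact h
    choose b hb using hb
    rw [← proj_eq_zero (K := K), Finsupp.sum, map_sum]
    refine Finset.sum_eq_zero fun q hq => proj_eq_zero.2 (hker q _ (hx q) ?_)
    have hcomp := congrArg (DirectSum.component K ℕ B q) hf
    rw [Finsupp.sum, map_sum, map_sum, Finset.sum_eq_single q, ← hb q,
      DirectSum.component.lof_self, map_zero] at hcomp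
    · rw [← hb q, hcomp, map_zero]
    · intro i _ hi
      rw [← hb i, DirectSum.component.of, dif_neg hi]
    · exact fun h => absurd hq h
  let e' := (TwoSidedIdeal.span S).ringCon.liftₐ φ hle
  have he' : ∀ f, e' (proj K S f) = φ f := fun f => rfl
  have hinj : Function.Injective e' := by
    intro x y hxy
    obtain ⟨x, rfl⟩ := proj_surjective K S x
    obtain ⟨y, rfl⟩ := proj_surjective K S y
    rw [he', he'] at hxy
    rw [← sub_eq_zero, ← map_sub, proj_eq_zero]
    apply hker'
    rw [sub_eq_add_neg, map_add, hxy, ← map_add, add_neg_cancel, map_zero]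
  have hsurj : Function.Surjective e' := by
    intro x
    induction x using DirectSum.induction_on with
    | zero => exact ⟨0, map_zero _⟩
    | of p b =>
      have h : DirectSum.lof K ℕ B p b ∈ (weightPart K wt p).map φ.toLinearMap := by
        rw [hmap]; exact ⟨b, rfl⟩
      obtain ⟨f, -, hf⟩ := h
      exact ⟨proj K S f, hf⟩
    | add x y hx hy =>
      obtain ⟨x, rfl⟩ := hx
      obtain ⟨y, rfl⟩ := hy
      exact ⟨x + y, map_add _ _ _⟩
  let e := AlgEquiv.ofBijective e' ⟨hinj, hsurj⟩
  have he : ∀ f, e.symm (φ f) = proj K S f := fun f => (e.symm_apply_eq).2 (he' f).symm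
  refine ⟨e.symm, fun p => ?_⟩
  ext y
  constructor
  · rintro ⟨_, hb, rfl⟩
    have hb' := (hmap p).ge hb
    obtain ⟨f, hf, rfl⟩ := hb'
    exact ⟨f, hf, (he f).symm⟩
  · rintro ⟨f, hf, rfl⟩
    exact ⟨φ f, (hmap p).le ⟨f, hf, rfl⟩, he f⟩

variable {A : Type*} [Ring A] [Algebra K A] (Φ : NFiltration K A)

/-- A homomorphism from the free algebra to a filtered algebra that sends each letter to the
filtration step of its weight lifts to a homomorphism to any graded algebra that receives the
filtration steps multiplicatively. -/
theorem exists_gradedHom {B : ℕ → Type*} [∀ p, AddCommMonoid (B p)] [∀ p, Module K (B p)]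
    [DirectSum.GSemiring B] [DirectSum.GAlgebra K B] (s : ∀ p, Φ.F p →ₗ[K] B p)
    (hone : DirectSum.lof K ℕ B 0 (s 0 ⟨1, Φ.one_mem⟩) = 1)
    (hmul : ∀ p q (a : Φ.F p) (b : Φ.F q),
      DirectSum.lof K ℕ B p (s p a) * DirectSum.lof K ℕ B q (s q b) =
        DirectSum.lof K ℕ B (p + q) (s (p + q) ⟨a.1 * b.1, Φ.mul_mem a.2 b.2⟩))
    (ρ : FreeAlgebra K α →ₐ[K] A) (hρ : ∀ p, ∀ f ∈ weightPart K wt p, ρ f ∈ Φ.F p) :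
    ∃ φ : FreeAlgebra K α →ₐ[K] ⨁ p, B p, ∀ p f (hf : f ∈ weightPart K wt p),
      φ f = DirectSum.lof K ℕ B p (s p ⟨ρ f, hρ p f hf⟩) := by
  -- Inside the direct sum, elements whose degrees are only propositionally equal can be compared
  -- without casts.
  have hcongr : ∀ {p q : ℕ} (_ : p = q) {a b : A} (_ : a = b) (ha : a ∈ Φ.F p) (hb : b ∈ Φ.F q),
      DirectSum.lof K ℕ B p (s p ⟨a, ha⟩) = DirectSum.lof K ℕ B q (s q ⟨b, hb⟩) := by
    rintro p _ rfl a _ rfl _ _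
    rfl
  let φ : FreeAlgebra K α →ₐ[K] ⨁ p, B p := FreeAlgebra.lift K fun a =>
    DirectSum.lof K ℕ B (wt a) (s (wt a) ⟨ρ (FreeAlgebra.ι K a), hρ _ _ (ι_mem_weightPart wt a)⟩)
  refine ⟨φ, fun p f hf => ?_⟩
  have hmon : ∀ w : FreeMonoid α, φ (monomial K w) = DirectSum.lof K ℕ B (wordDeg wt w)
      (s _ ⟨ρ (monomial K w), hρ _ _ (monomial_mem_weightPart wt w)⟩) := by
    intro w
    induction w using FreeMonoid.inductionOn' with
    | one =>
      refine (congrArg φ (map_one (monomial K))).trans ((map_one φ).trans (hone.symm.trans ?_))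
      exact hcongr rfl (by simp) _ _
    | of_mul a w ih =>
      have ha : φ (monomial K (FreeMonoid.of a)) = DirectSum.lof K ℕ B (wt a)
          (s (wt a) ⟨ρ (FreeAlgebra.ι K a), hρ _ _ (ι_mem_weightPart wt a)⟩) := by
        rw [monomial_of]
        exact FreeAlgebra.lift_ι_apply _ _
      refine (congrArg φ (map_mul (monomial K) _ _)).trans ((map_mul φ _ _).trans ?_)
      rw [ih, ha, hmul]
      exact hcongr (by rw [wordDeg_mul, wordDeg_of]) (by rw [map_mul, map_mul, monomial_of]) _ _
  induction hf using Submodule.span_induction with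
  | mem x hx =>
    obtain ⟨w, rfl, rfl⟩ := hx
    exact hmon w
  | zero =>
    rw [map_zero]
    have h : (⟨ρ 0, hρ p 0 (Submodule.zero_mem _)⟩ : Φ.F p) = 0 := Subtype.ext (map_zero ρ)
    rw [h, map_zero, map_zero]
  | add x y hx hy ihx ihy =>
    rw [map_add, ihx, ihy, ← map_add, ← map_add]
    exact hcongr rfl (map_add ρ x y).symm _ _
  | smul c x hx ih =>
    rw [map_smul, ih, ← map_smul, ← map_smul]
    exact hcongr rfl (map_smul ρ c x).symm _ _

end GradedHom

/-! ### The Rees algebra and the associated graded algebra -/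

section Main

variable {K : Type*} [Field K] {ι : Type*} {wt : ι → ℕ}

theorem proj_mem_quotFiltration (S : Set (FreeAlgebra K ι)) {p : ℕ} {f : FreeAlgebra K ι}
    (hf : f ∈ (weightFiltration K wt).F p) : proj K S f ∈ (quotFiltration wt S).F p :=
  ⟨f, hf, rfl⟩

theorem mem_prev_quotFiltration {S : Set (FreeAlgebra K ι)} {p : ℕ} {a : Quot S} :
    a ∈ (quotFiltration wt S).prev p ↔
      ∃ f ∈ (weightFiltration K wt).prev p, proj K S f = a := by
  cases p with
  | zero =>
    simp only [NFiltration.prev, Submodule.mem_bot]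
    constructor
    · rintro rfl
      exact ⟨0, rfl, map_zero _⟩
    · rintro ⟨_, rfl, rfl⟩
      exact map_zero _
  | succ p => exact Iff.rfl

theorem weightFiltration_F_eq_sup (p : ℕ) :
    (weightFiltration K wt).F p = weightPart K wt p ⊔ (weightFiltration K wt).prev p := by
  refine le_antisymm (iSup₂_le fun i hi => ?_)
    (sup_le (weightPart_le_weightFiltration wt le_rfl) ?_)
  · rcases hi.eq_or_lt with rfl | hlt
    · exact le_sup_left
    · cases p with
      | zero => exact absurd hlt (Nat.not_lt_zero i)
      | succ p =>
        exact (weightPart_le_weightFiltration wt (Nat.lt_succ_iff.1 hlt)).trans le_sup_right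
  · cases p with
    | zero => exact bot_le
    | succ p => exact (weightFiltration K wt).le_succ p

variable [LinearOrder ι] [Finite ι] {G : Set (FreeAlgebra K (WithBot ι))}

theorem IsDhClosedGroebnerBasis.rees_gradedIso (hwt : ∀ i, 0 < wt i)
    (hG : IsDhClosedGroebnerBasis wt G) :
    GradedIso (R := (quotFiltration wt (dehom K ι '' G)).Rees) (S := Quot G)
      (reesPart (quotFiltration wt (dehom K ι '' G))) (quotPart (extWt wt) G) := by
  set Φ := quotFiltration wt (dehom K ι '' G)
  have hρ : ∀ p, ∀ F ∈ weightPart K (extWt wt) p,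
      ((proj K (dehom K ι '' G)).comp (dehom K ι)) F ∈ Φ.F p :=
    fun p F hF => proj_mem_quotFiltration _ (dehom_mem hF)
  obtain ⟨φ, hφ⟩ := exists_gradedHom Φ (B := fun p => Φ.F p) (fun p => LinearMap.id) rfl
    (fun p q a b => DirectSum.of_mul_of (A := fun p => Φ.F p) a b) _ hρ
  refine gradedIso_quotPart φ (fun p => le_antisymm ?_ ?_) ?_ ?_
  · rintro _ ⟨F, hF, rfl⟩
    exact ⟨_, (hφ p F hF).symm⟩
  · rintro _ ⟨⟨_, f, hf, rfl⟩, rfl⟩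
    obtain ⟨F, hF, rfl⟩ := exists_dehom_eq hf
    exact ⟨F, hF, hφ p F hF⟩
  · intro g hg
    obtain ⟨p, hp⟩ := hG.exists_mem_weightPart hg
    rw [hφ p g hp]
    have h0 : (⟨_, hρ p g hp⟩ : Φ.F p) = 0 :=
      Subtype.ext (proj_eq_zero (K := K).2 (TwoSidedIdeal.subset_span ⟨g, hg, rfl⟩))
    rw [h0, map_zero, map_zero]
  · intro p F hF h0
    rw [hφ p F hF] at h0
    have h := congrArg Subtype.val (DirectSum.of_injective (β := fun p => Φ.F p) p
      (h0.trans (map_zero (DirectSum.of (fun p => Φ.F p) p)).symm))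
    exact hG.mem_span_of_dehom_mem hwt hF (proj_eq_zero (K := K).1 h)

/-- The relation `f ≡ h` of `A` lifts to `f - TQ ∈ ⟨G⟩`, homogeneous of degree `p`; the lower-order
part is divisible by `T` and vanishes at `T = 0`. This gives the kernel for `G(A)`. -/
theorem IsDhClosedGroebnerBasis.mem_span_LH (hwt : ∀ i, 0 < wt i)
    (hG : IsDhClosedGroebnerBasis wt G) {p : ℕ} {f h : FreeAlgebra K ι}
    (hf : f ∈ weightPart K wt p) (hh : h ∈ (weightFiltration K wt).prev p)
    (hfh : f - h ∈ TwoSidedIdeal.span (dehom K ι '' G)) :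
    f ∈ TwoSidedIdeal.span (LH wt '' (dehom K ι '' G)) := by
  -- The degree condition is put on `T Q` rather than on `Q`, so that `p = 0` is covered by `h = 0`
  -- and `Q = 0`.
  obtain ⟨Q, hQ, rfl⟩ : ∃ Q, T K ι * Q ∈ weightPart K (extWt wt) p ∧ dehom K ι Q = h := by
    cases p with
    | zero =>
      rw [NFiltration.prev, Submodule.mem_bot] at hh
      exact ⟨0, by simp, by simp [hh]⟩
    | succ p =>
      obtain ⟨Q, hQ, hQh⟩ := exists_dehom_eq (wt := wt) (p := p) hh
      refine ⟨Q, ?_, hQh⟩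
      rw [add_comm]
      exact mul_mem_weightPart T_mem_weightPart hQ
  have hP := hG.mem_span_of_dehom_mem hwt (Submodule.sub_mem _ (incl_mem_weightPart hf) hQ)
    (by simpa using hfh)
  -- Setting `T = 0` maps `⟨G⟩` into `⟨LH(G_∼)⟩`; it suffices to check this on generators.
  have hle : TwoSidedIdeal.span G ≤
      TwoSidedIdeal.ker ((proj K (LH wt '' (dehom K ι '' G))).comp (evalTZero K ι)) := by
    refine TwoSidedIdeal.span_le.2 fun g hg => (TwoSidedIdeal.mem_ker _).2 ?_
    rw [AlgHom.comp_apply]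
    rcases hG.evalTZero_eq hg with h0 | h0
    · rw [h0, map_zero]
    · rw [h0, proj_eq_zero]
      exact TwoSidedIdeal.subset_span ⟨_, ⟨g, hg, rfl⟩, rfl⟩
  have h0 := (TwoSidedIdeal.mem_ker _).1 (hle hP)
  rw [AlgHom.comp_apply, proj_eq_zero] at h0
  simpa using h0

theorem IsDhClosedGroebnerBasis.assocGraded_gradedIso (hwt : ∀ i, 0 < wt i)
    (hG : IsDhClosedGroebnerBasis wt G) :
    GradedIso (R := (quotFiltration wt (dehom K ι '' G)).AssocGraded)
      (S := Quot (LH wt '' (dehom K ι '' G)))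
      (grPart (quotFiltration wt (dehom K ι '' G)))
      (quotPart wt (LH wt '' (dehom K ι '' G))) := by
  set Φ := quotFiltration wt (dehom K ι '' G)
  have hρ : ∀ p, ∀ f ∈ weightPart K wt p, proj K (dehom K ι '' G) f ∈ Φ.F p :=
    fun p f hf => proj_mem_quotFiltration _ (weightPart_le_weightFiltration wt le_rfl hf)
  obtain ⟨φ, hφ⟩ := exists_gradedHom Φ (B := Φ.Gr) Φ.symb rfl
    (fun p q a b => DirectSum.of_mul_of (A := Φ.Gr) (Φ.symb p a) (Φ.symb q b)) _ hρ
  refine gradedIso_quotPart φ (fun p => le_antisymm ?_ ?_) ?_ ?_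
  · rintro _ ⟨f, hf, rfl⟩
    exact ⟨_, (hφ p f hf).symm⟩
  · rintro _ ⟨x, rfl⟩
    obtain ⟨⟨_, y, hy, rfl⟩, rfl⟩ := Φ.symb_surjective p x
    change y ∈ (weightFiltration K wt).F p at hy
    -- Only the degree-`p` part of a representative contributes to its symbol, so `f` alone is a
    -- preimage.
    rw [weightFiltration_F_eq_sup] at hy
    obtain ⟨f, hf, h, hh, rfl⟩ := Submodule.mem_sup.1 hy
    refine ⟨f, hf, (hφ p f hf).trans (congrArg _ ?_)⟩
    rw [eq_comm, ← sub_eq_zero, ← map_sub]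
    refine Φ.symb_eq_zero (mem_prev_quotFiltration.2 ⟨h, hh, ?_⟩)
    change proj K _ h = proj K _ (f + h) - proj K _ f
    rw [map_add, add_sub_cancel_left]
  · rintro _ ⟨r, hr, rfl⟩
    have hr0 : proj K (dehom K ι '' G) r = 0 := proj_eq_zero.2 (TwoSidedIdeal.subset_span hr)
    rw [hφ (polyDeg wt r) _ (LH_mem_weightPart wt r), Φ.symb_eq_zero, map_zero]
    -- In `A` the element `r` is zero, so `-LH(r)` equals the class of `r - LH(r)`, which has lower
    -- degree.
    rw [← neg_mem_iff]
    refine mem_prev_quotFiltration.2 ⟨_, sub_LH_mem_prev wt r, ?_⟩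
    rw [map_sub, hr0, zero_sub]
  · intro p f hf h0
    rw [hφ p f hf] at h0
    have h := DirectSum.of_injective (β := Φ.Gr) p
      (h0.trans (map_zero (DirectSum.of Φ.Gr p)).symm)
    have h' : proj K (dehom K ι '' G) f ∈ Φ.prev p :=
      (Submodule.Quotient.mk_eq_zero ((Φ.prev p).submoduleOf (Φ.F p))).1 h
    obtain ⟨h, hh, hfh⟩ := mem_prev_quotFiltration.1 h'
    refine hG.mem_span_LH hwt hf hh (proj_eq_zero (K := K).1 ?_)
    rw [map_sub, hfh, sub_self]

end Main

end NCGroebner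

theorem proposition4p2 {K : Type*} [Field K] {ι : Type*} [Finite ι] [LinearOrder ι]
    (wt : ι → ℕ) (hwt : ∀ i, 0 < wt i)
    (G : Set (FreeAlgebra K (WithBot ι)))
    (hG : NCGroebner.IsDhClosedGroebnerBasis wt G) :
    NCGroebner.GradedIso
        (R := (NCGroebner.quotFiltration wt (NCGroebner.dehom K ι '' G)).AssocGraded)
        (S := NCGroebner.Quot (NCGroebner.LH wt '' (NCGroebner.dehom K ι '' G)))
        (NCGroebner.grPart (NCGroebner.quotFiltration wt (NCGroebner.dehom K ι '' G)))
        (NCGroebner.quotPart wt (NCGroebner.LH wt '' (NCGroebner.dehom K ι '' G))) ∧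
      NCGroebner.GradedIso
        (R := (NCGroebner.quotFiltration wt (NCGroebner.dehom K ι '' G)).Rees)
        (S := NCGroebner.Quot G)
        (NCGroebner.reesPart (NCGroebner.quotFiltration wt (NCGroebner.dehom K ι '' G)))
        (NCGroebner.quotPart (NCGroebner.extWt wt) G) :=
  ⟨hG.assocGraded_gradedIso hwt, hG.rees_gradedIso hwt⟩
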